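/- Let $\mathcal{R}=(V,R)$ be the random graph, i.e. the (up to isomorphism unique) countable graph such that for every pair of disjoint finite sets $A,B\subset V$ there is $v\in V$ with $xRv$ for all $x\in A$ and $y\not\mathrel{R}v$ for all $y\in B$. Equip $\mathrm{Aut}(\mathcal{R})$ with the topology of pointwise convergence ($V$ being discrete). For $f\in\mathrm{Aut}(\mathcal{R})$ and $M\subset V$ put $\mathcal{O}^f(M)=\{f^k(v): v\in M,\ k\in\mathbb{Z}\}$. For a finite $M\subset V$ and $\tau:M\to\{0,1\}$, a vertex $v$ realizes $\tau$ if for every $w\in M$: $wRv\iff\tau(w)=1$. We say that $f$ has property $(*)_0$ (resp. $(*)_1$) if (a) $f$ has only finitely many finite orbits and infinitely many infinite orbits, and (b) for every finite $M\subset V$ and every $\tau:M\to\{0,1\}$ there is $v\in V$ that realizes $\tau$ with $v\notin\mathcal{O}^f(M)$ and $v\not\mathrel{R}f(v)$ (resp. $vRf(v)$). Theorem. Suppose that $f\in\mathrm{Aut}(\mathcal{R})$ has property $(*)_0$ or $(*)_1$, and let $N$ be the union of the finite orbits of $f$. Let $\mathcal{K}\subset\mathrm{Aut}(\mathcal{R})$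 be a compact set such that $h|_N=f|_N$ for every $h\in\mathcal{K}$. Then $\mathcal{K}$ can be translated into the conjugacy class of $f$, that is, there are $a,b\in\mathrm{Aut}(\mathcal{R})$ such that $a\mathcal{K}b$ is contained in the conjugacy class of $f$. In fact, there exist $g\in\mathrm{Aut}(\mathcal{R})$ and $\phi_h\in\mathrm{Aut}(\mathcal{R})$ $(h\in\mathcal{K})$ such that $g|_N=\phi_h|_N=\mathrm{id}_N$ and $\phi_h\circ h\circ g=f\circ\phi_h$ for every $h\in\mathcal{K}$. -/

import Mathlib

namespace RandomGraph

/-- The defining property of the random graph among countable graphs: for all finite disjoint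
sets `A`, `B` of vertices some vertex is adjacent to everything in `A` and to nothing in `B`. -/
def IsRandomGraph {V : Type*} (R : SimpleGraph V) : Prop :=
  ∀ A B : Finset V, Disjoint A B →
    ∃ v : V, (∀ x ∈ A, R.Adj x v) ∧ ∀ y ∈ B, ¬ R.Adj y v

/-- The topology of pointwise convergence on the automorphism group of a graph, the vertex set
being discrete. -/
instance autTopology {V : Type*} (R : SimpleGraph V) : TopologicalSpace (R ≃g R) :=
  TopologicalSpace.induced (fun (h : R ≃g R) (v : V) => h v)
    (@Pi.topologicalSpace V (fun _ => V) (fun _ => ⊥))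

variable {V : Type*} {R : SimpleGraph V}

/-- The set of all `f ^ k v` with `v ∈ A` and `k` an integer. -/
def orbitUnion (f : R ≃g R) (A : Set V) : Set V :=
  {w | ∃ v ∈ A, ∃ k : ℤ, (f ^ k) v = w}

/-- The set of all orbits of `f`. -/
def orbits (f : R ≃g R) : Set (Set V) :=
  {O | ∃ v : V, O = orbitUnion f {v}}

/-- The union of the finite orbits of `f`. -/
def finiteOrbitsUnion (f : R ≃g R) : Set V :=
  ⋃₀ {O | O ∈ orbits f ∧ O.Finite}

/-- `v` realizes `τ : M → {0, 1}`. -/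
def Realizes (R : SimpleGraph V) (M : Finset V) (τ : M → Fin 2) (v : V) : Prop :=
  ∀ w : M, R.Adj w v ↔ τ w = 1

/-- Only finitely many finite orbits and infinitely many infinite orbits. -/
def OrbitCondition (f : R ≃g R) : Prop :=
  {O | O ∈ orbits f ∧ O.Finite}.Finite ∧ {O | O ∈ orbits f ∧ O.Infinite}.Infinite

/-- Property `(*)₀`. -/
def StarZero (f : R ≃g R) : Prop :=
  OrbitCondition f ∧
    ∀ (M : Finset V) (τ : M → Fin 2),
      ∃ v : V, Realizes R M τ v ∧ v ∉ orbitUnion f (M : Set V) ∧ ¬ R.Adj v (f v)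

/-- Property `(*)₁`. -/
def StarOne (f : R ≃g R) : Prop :=
  OrbitCondition f ∧
    ∀ (M : Finset V) (τ : M → Fin 2),
      ∃ v : V, Realizes R M τ v ∧ v ∉ orbitUnion f (M : Set V) ∧ R.Adj v (f v)

/-- Some two-sided translate `a K b` is contained in `S`. -/
def CanBeTranslatedInto {G : Type*} [Group G] (K S : Set G) : Prop :=
  ∃ a b : G, ∀ h ∈ K, a * h * b ∈ S

end RandomGraph

/-!
Compactness of `K` is used only through the finiteness of the sets `{h v | h ∈ K}` and
`{h⁻¹ v | h ∈ K}`. The automorphisms `g` and `φ_h` are built together from finite approximations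
(`Approx`) by a back-and-forth argument for all `h ∈ K` simultaneously, where `φ_h` depends on a
finite part of `h` at each stage. The construction starts with the identity on `N`.

The difficulty is that `g` is shared. Suppose that `φ_h x` is already known and that `g x` is to be
chosen. The equation `φ_h h g = f φ_h` demands that `g x` be adjacent to `u` exactly if `f (φ_h x)`
is adjacent to `φ_h (h u)`, as soon as the latter is defined, and different `h` must not ask for
different things. An approximation therefore carries a relation `s`, on which all `h` agree, saying
whether `g x` is going to be adjacent to `u`.

When a vertex `x` is added to the domain of `φ_h` (`Approx.exists_domain`), its image is taken in a
new orbit of `f` and can be chosen to respect `s`. The only adjacency that cannot be prescribed is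
the one between `φ_h x` and `f (φ_h x)`, and `(*)₀` or `(*)₁` makes it the same for all `h`. In the
two steps where adjacencies are dictated, namely the definition of `g` at a new vertex
(`Approx.exists_extend`) and the addition of a vertex to the range of `φ_h`
(`Approx.exists_range_class`), the new vertex is chosen so that its image under `h`, or under
`h⁻¹`, determines the part of `h` which matters (`Setting.exists_type_splits`). Then automorphisms
which are treated differently make demands about different pairs of vertices.

Inverting `f`, `g` and all `h`, and replacing `φ_h` by `φ_h h`, turns the problem into one of the
same kind. This duality (`Approx.dual`) makes `g` surjective.
-/

namespace RandomGraph

open Set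

/-! ### The setting and its types -/

/-- The data of the conjugation problem: an automorphism `f` with its finite invariant set `N`, and
a family `h` of automorphisms which moves every vertex to finitely many places, as do the inverses.
This finiteness is all that is left of compactness. The proposition `ε` decides between `(*)₀`
(`ε` false) and `(*)₁` (`ε` true): both provide, for every type over a finite set, a realization `v`
in a new orbit of `f` such that `v` is adjacent to `f v` exactly if `ε` holds. -/
structure Setting {V : Type*} (R : SimpleGraph V) (ι : Type*) where
  f : R ≃g R
  h : ι → R ≃g R
  N : Set V
  ε : Prop
  finite_N : N.Finite
  mem_N : ∀ (n : ℕ) (t : V), (f ^ (n + 1)) t = t → t ∈ N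
  finite_orbit : ∀ v, (range fun i => h i v).Finite
  finite_orbit_inv : ∀ v, (range fun i => (h i)⁻¹ v).Finite
  exists_realizes : ∀ (M : Set V) (τ : V → Prop), M.Finite → ∃ v,
    (∀ w ∈ M, R.Adj w v ↔ τ w) ∧ (∀ w ∈ M, ∀ k : ℤ, (f ^ k) w ≠ v) ∧ (R.Adj v (f v) ↔ ε)

variable {V ι : Type*} {R : SimpleGraph V}

namespace Setting

variable (S : Setting R ι)

@[simp] theorem h_adj (i : ι) (a b : V) : R.Adj (S.h i a) (S.h i b) ↔ R.Adj a b :=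
  (S.h i).map_rel_iff

@[simp] theorem f_adj (a b : V) : R.Adj (S.f a) (S.f b) ↔ R.Adj a b :=
  S.f.map_rel_iff

@[simp] theorem h_h_inv (i : ι) (a : V) : S.h i ((S.h i)⁻¹ a) = a :=
  (S.h i).apply_symm_apply a

@[simp] theorem h_inv_h (i : ι) (a : V) : (S.h i)⁻¹ (S.h i a) = a :=
  (S.h i).symm_apply_apply a

@[simp] theorem f_f_inv (a : V) : S.f (S.f⁻¹ a) = a := S.f.apply_symm_apply a

@[simp] theorem f_inv_f (a : V) : S.f⁻¹ (S.f a) = a := S.f.symm_apply_apply a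

/-- If `(h i)⁻¹` and `(h j)⁻¹` agree at `h i u`, then `h i` and `h j` agree at `u`. -/
theorem h_apply_eq_of_inv_apply_eq {i j : ι} {u : V}
    (h : (S.h i)⁻¹ (S.h i u) = (S.h j)⁻¹ (S.h i u)) : S.h i u = S.h j u := by
  rw [h_inv_h] at h
  conv_rhs => rw [h, h_h_inv]

theorem inv_apply_eq_of_h_apply_eq {i j : ι} {x : V}
    (h : S.h i ((S.h i)⁻¹ x) = S.h j ((S.h i)⁻¹ x)) : (S.h i)⁻¹ x = (S.h j)⁻¹ x := by
  rw [h_h_inv] at h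
  conv_rhs => rw [h, h_inv_h]

theorem adj_h_left (i : ι) (a b : V) : R.Adj (S.h i a) b ↔ R.Adj a ((S.h i)⁻¹ b) := by
  rw [← S.h_adj i a, h_h_inv]

theorem f_pow_succ (n : ℕ) (t : V) : (S.f ^ (n + 1)) t = S.f ((S.f ^ n) t) := by
  rw [pow_succ']; rfl

theorem f_pow_succ' (n : ℕ) (t : V) : (S.f ^ (n + 1)) t = (S.f ^ n) (S.f t) := by
  rw [pow_succ]; rfl

/-- The setting with `f` and all `h i` inverted. Since `φ h g = f φ` is equivalent to
`(φ h) h⁻¹ g⁻¹ = f⁻¹ (φ h)`, solutions for one setting are solutions for the other. Taking the dual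
twice gives back the same setting definitionally. -/
def dual : Setting R ι where
  f := S.f⁻¹
  h i := (S.h i)⁻¹
  N := S.N
  ε := S.ε
  finite_N := S.finite_N
  mem_N n t ht := S.mem_N n t <| by
    conv_lhs => rw [← ht, inv_pow]
    exact RelIso.apply_symm_apply _ _
  finite_orbit := S.finite_orbit_inv
  finite_orbit_inv v := by simpa using S.finite_orbit v
  exists_realizes M τ hM := by
    obtain ⟨v, h1, h2, h3⟩ := S.exists_realizes M τ hM
    refine ⟨v, h1, fun w hw k => ?_, ?_⟩
    · rw [inv_zpow, ← zpow_neg]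
      exact h2 w hw _
    · rw [← h3, ← S.f_adj, f_f_inv, R.adj_comm]

theorem finite_image {X : Set V} (hX : X.Finite) : {w | ∃ i, ∃ x ∈ X, S.h i x = w}.Finite := by
  refine (hX.biUnion fun x _ => S.finite_orbit x).subset ?_
  rintro w ⟨i, x, hx, rfl⟩
  exact mem_biUnion hx ⟨i, rfl⟩

theorem finite_image_inv {X : Set V} (hX : X.Finite) :
    {w | ∃ i, ∃ x ∈ X, (S.h i)⁻¹ x = w}.Finite :=
  S.dual.finite_image hX

theorem exists_type (S : Setting R ι) (M X : Set V) (τ : V → Prop) (hM : M.Finite) (hX : X.Finite) :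
    ∃ v, (∀ w ∈ M, R.Adj w v ↔ τ w) ∧ v ∉ X := by
  obtain ⟨v, h1, h2, -⟩ := S.exists_realizes (M ∪ X) τ (hM.union hX)
  exact ⟨v, fun w hw => h1 w (.inl hw), fun hv => h2 v (.inr hv) 0 rfl⟩

/-- On a finite set only finitely many different restrictions of the `h i` occur. -/
theorem exists_finite_representatives {F : Set V} (hF : F.Finite) :
    ∃ J : Set ι, J.Finite ∧ ∀ i, ∃ j ∈ J, ∀ v ∈ F, S.h i v = S.h j v := by
  have := hF.to_subtype
  let r : ι → F → V := fun i v => S.h i v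
  have hr : (range r).Finite := by
    refine (Set.Finite.pi fun v : F => S.finite_orbit v).subset ?_
    rintro _ ⟨i, rfl⟩ v -
    exact ⟨i, rfl⟩
  have := hr.to_subtype
  refine ⟨range fun c : range r => c.2.choose, finite_range _, fun i =>
    ⟨_, ⟨⟨r i, i, rfl⟩, rfl⟩, fun v hv => ?_⟩⟩
  exact congrFun (Exists.choose_spec (⟨i, rfl⟩ : r i ∈ range r)).symm ⟨v, hv⟩

/-- Some vertex `y` determines the `h i` on a given finite set `F`, in that `h i y = h j y` forces
`h i` and `h j` to agree on `F`. To pass from `F` to `insert q F`, take `y` for `F` and a neighbor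
`z` of `q` and `y` which is adjacent to no other `(h i)⁻¹ (h j q)` or `(h i)⁻¹ (h j y)`. If `h i` and
`h j` agree at `z`, then `(h i)⁻¹ (h j q)` and `(h i)⁻¹ (h j y)` are neighbors of `z`, and they cannot
be interchanged when `y` is not of the form `(h i)⁻¹ (h j q)`. -/
theorem exists_splits_notMem {F : Set V} (hF : F.Finite) : ∀ X : Set V, X.Finite →
    ∃ y ∉ X, ∀ i j, S.h i y = S.h j y → ∀ v ∈ F, S.h i v = S.h j v := by
  induction F, hF using Set.Finite.induction_on with
  | empty =>
    intro X hX
    obtain ⟨y, -, hy⟩ := S.exists_type ∅ X (fun _ => True) finite_empty hX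
    exact ⟨y, hy, by simp⟩
  | @insert q F _ _ ih =>
    intro X hX
    obtain ⟨y, hy, hyF⟩ := ih _ (S.finite_image_inv (S.finite_image (finite_singleton q)))
    obtain ⟨z, hz, hzX⟩ := S.exists_type
      {w | ∃ i, ∃ x ∈ {w | ∃ i, ∃ x ∈ ({q, y} : Set V), S.h i x = w}, (S.h i)⁻¹ x = w} X
      (fun w => w = q ∨ w = y)
      (S.finite_image_inv (S.finite_image (toFinite _))) hX
    refine ⟨z, hzX, fun i j hij => ?_⟩
    have key : ∀ p, p = q ∨ p = y → (S.h i)⁻¹ (S.h j p) = q ∨ (S.h i)⁻¹ (S.h j p) = y := by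
      intro p hp
      rw [← hz _ ⟨i, _, ⟨j, p, hp, rfl⟩, rfl⟩, ← S.h_adj i, h_h_inv, hij, h_adj]
      refine (hz p ⟨i, S.h i p, ⟨i, p, hp, rfl⟩, by simp⟩).2 hp
    have hq : S.h i q = S.h j q := by
      rcases key q (.inl rfl) with h | h
      · rw [← S.h_h_inv i (S.h j q), h]
      · exact absurd ⟨i, _, ⟨j, q, rfl, rfl⟩, h⟩ hy
    have hy' : S.h i y = S.h j y := by
      rcases key y (.inr rfl) with h | h
      · refine absurd ⟨j, _, ⟨i, q, rfl, rfl⟩, ?_⟩ hy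
        rw [← h]; simp
      · rw [← S.h_h_inv i (S.h j y), h]
    rintro v (rfl | hv)
    · exact hq
    · exact hyF i j hy' v hv

/-- Every type over a finite set is realized by a vertex `z` such that `h i z` determines `h i` on
a given finite set. -/
theorem exists_type_splits (S : Setting R ι) {M X F : Set V} (τ : V → Prop) (hM : M.Finite)
    (hX : X.Finite) (hF : F.Finite) :
    ∃ z, (∀ w ∈ M, R.Adj w z ↔ τ w) ∧ z ∉ X ∧
      ∀ i j, S.h i z = S.h j z → ∀ v ∈ F, S.h i v = S.h j v := by
  obtain ⟨y, hy, hyF⟩ := S.exists_splits_notMem hF _ (hM.union (S.finite_image_inv (S.finite_image hM)))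
  have hM' : ∀ i j, (S.h i)⁻¹ (S.h j y) ∉ M := fun i j h =>
    hy (.inr ⟨j, _, ⟨i, _, h, rfl⟩, by simp⟩)
  obtain ⟨z, hz, hzX⟩ := S.exists_type
    (M ∪ {w | ∃ i, ∃ x ∈ {w | ∃ i, ∃ x ∈ ({y} : Set V), S.h i x = w}, (S.h i)⁻¹ x = w}) X
    (fun w => (w ∈ M ∧ τ w) ∨ w = y)
    (hM.union (S.finite_image_inv (S.finite_image (toFinite _)))) hX
  have hyM : y ∉ M := fun h => hy (.inl h)
  refine ⟨z, fun w hw => ?_, hzX, fun i j hij => hyF i j ?_⟩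
  · rw [hz w (.inl hw)]
    have : w ≠ y := by rintro rfl; exact hyM hw
    simp [hw, this]
  · have h1 : R.Adj ((S.h i)⁻¹ (S.h j y)) z := by
      rw [← S.h_adj i, h_h_inv, hij, h_adj]
      exact (hz y (.inr ⟨i, S.h i y, ⟨i, y, rfl, rfl⟩, by simp⟩)).2 (.inr rfl)
    rcases (hz _ (.inr ⟨i, _, ⟨j, y, rfl, rfl⟩, rfl⟩)).1 h1 with h | h
    · exact absurd h.1 (hM' i j)
    · rw [← S.h_h_inv i (S.h j y), h]

end Setting

/-! ### Finite approximations -/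

/-- A finite approximation to a solution of `φ i ∘ h i ∘ g = f ∘ φ i`: graphs `g` and `φ i` of
finite partial automorphisms, where `φ i` depends on a finite part of `h i` only.

The relation `s` records promises: `s x u` stands for the adjacency of `g x` and `u`, which is
determined by `φ i` as soon as `x` and `h i u` belong to the domain of `φ i`, because then the
equation makes it equivalent to the adjacency of `f (φ i x)` and `φ i (h i u)`. That all `φ i`
agree about it, which is `s_φ`, is what makes it possible to extend `g` for all `i` at once.

By `gap`, an orbit of `f` meets the range of `φ i` in at most one segment, coming from one segment
of an orbit of `h i ∘ g`. By `s_free`, a vertex `x` outside of the domain of `φ i` has the default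
promise about `(h i)⁻¹ x`, so that `φ i x` may be chosen with `φ i x` and `f (φ i x)` related
as `ε` says. -/
structure Approx (S : Setting R ι) where
  g : V → V → Prop
  φ : ι → V → V → Prop
  s : V → V → Prop
  φ_finite : ∀ i, {p : V × V | φ i p.1 p.2}.Finite
  φ_determined : ∃ F : Set V, F.Finite ∧
    ∀ i j, (∀ v ∈ F, S.h i v = S.h j v) → φ i = φ j
  φ_inj : ∀ {i x t x' t'}, φ i x t → φ i x' t' → (x = x' ↔ t = t')
  φ_adj : ∀ {i x t x' t'}, φ i x t → φ i x' t' → (R.Adj x x' ↔ R.Adj t t')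
  φ_g : ∀ {x y}, g x y → ∀ i, ∃ t, φ i x t ∧ φ i (S.h i y) (S.f t)
  gap : ∀ {i x t u n}, φ i x t → φ i (S.h i u) ((S.f ^ (n + 1)) t) →
    (∃ y, g x y) ∧ ∃ x', g x' u
  s_φ : ∀ {i x t u t'}, φ i x t → φ i (S.h i u) t' → (s x u ↔ R.Adj (S.f t) t')
  s_left : ∀ {x y} u, g x y → (s x u ↔ R.Adj y u)
  s_right : ∀ {x y} x', g x y → (s x' y ↔ R.Adj x' x)
  s_free : ∀ {i u}, (¬ ∃ t, φ i (S.h i u) t) → (s (S.h i u) u ↔ S.ε)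

namespace Approx

variable {S : Setting R ι}

/-- One approximation extends another if its `g` and `φ` do. The promises are not compared. -/
instance : Preorder (Approx S) where
  le σ τ := (∀ x y, σ.g x y → τ.g x y) ∧ ∀ i x t, σ.φ i x t → τ.φ i x t
  le_refl _ := ⟨fun _ _ => id, fun _ _ _ => id⟩
  le_trans _ _ _ h h' := ⟨fun _ _ => h'.1 _ _ ∘ h.1 _ _, fun _ _ _ => h'.2 _ _ _ ∘ h.2 _ _ _⟩

theorem domain_finite_of_determined {φ : ι → V → V → Prop} {F : Set V} (hF : F.Finite)
    (hφ : ∀ i j, (∀ v ∈ F, S.h i v = S.h j v) → φ i = φ j)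
    (hfin : ∀ i, {p : V × V | φ i p.1 p.2}.Finite) : {x | ∃ i t, φ i x t}.Finite := by
  obtain ⟨J, hJ, h⟩ := S.exists_finite_representatives hF
  refine (hJ.biUnion fun j _ => (hfin j).image Prod.fst).subset ?_
  rintro x ⟨i, t, ht⟩
  obtain ⟨j, hj, hij⟩ := h i
  rw [hφ i j hij] at ht
  exact mem_biUnion hj ⟨(x, t), ht, rfl⟩

variable (σ : Approx S)

theorem domain_finite : {x | ∃ i t, σ.φ i x t}.Finite :=
  let ⟨_, hF, h⟩ := σ.φ_determined
  domain_finite_of_determined hF h σ.φ_finite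

theorem range_finite (i : ι) : {t | ∃ x, σ.φ i x t}.Finite := by
  refine ((σ.φ_finite i).image Prod.snd).subset ?_
  rintro t ⟨x, hx⟩
  exact ⟨(x, t), hx, rfl⟩

/-- A finite part of `h i` determines `φ i` together with the preimage of its domain
under `h i`. -/
theorem exists_strongly_determined : ∃ F : Set V, F.Finite ∧
    ∀ i j, (∀ v ∈ F, S.h i v = S.h j v) →
      σ.φ i = σ.φ j ∧ ∀ x t, σ.φ i x t → (S.h i)⁻¹ x = (S.h j)⁻¹ x := by
  obtain ⟨F, hF, h⟩ := σ.φ_determined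
  refine ⟨F ∪ _, hF.union (S.finite_image_inv σ.domain_finite), fun i j hij =>
    ⟨h i j fun v hv => hij v (.inl hv), fun x t hx => ?_⟩⟩
  exact S.inv_apply_eq_of_h_apply_eq (hij _ (.inr ⟨i, x, ⟨i, t, hx⟩, rfl⟩))

theorem φ_of_g {x y : V} {i : ι} {t : V} (hg : σ.g x y) (ht : σ.φ i x t) :
    σ.φ i (S.h i y) (S.f t) := by
  obtain ⟨t', h1, h2⟩ := σ.φ_g hg i
  rwa [(σ.φ_inj ht h1).1 rfl]

theorem g_of_φ {i : ι} {x t u : V} (h1 : σ.φ i x t) (h2 : σ.φ i (S.h i u) (S.f t)) :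
    σ.g x u := by
  obtain ⟨⟨y, hy⟩, -⟩ := σ.gap (n := 0) h1 (by simpa using h2)
  have := (σ.φ_inj (σ.φ_of_g hy h1) h2).2 rfl
  rwa [← (S.h i).injective this]

/-- An approximation seen as one in the dual setting: `g` is inverted, and `φ i` is replaced by
`φ i ∘ h i`. -/
def dual : Approx S.dual where
  g x y := σ.g y x
  φ i u t := σ.φ i (S.h i u) t
  s x y := σ.s y x
  φ_finite i := (σ.φ_finite i).preimage (f := fun p : V × V => (S.h i p.1, p.2)) <| by
    rintro ⟨a, b⟩ - ⟨c, d⟩ - h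
    simpa using h
  φ_determined := by
    obtain ⟨F, hF, h⟩ := σ.exists_strongly_determined
    refine ⟨_, S.finite_image hF, fun i j hij => ?_⟩
    have hij' : ∀ v ∈ F, S.h i v = S.h j v := fun v hv =>
      S.h_apply_eq_of_inv_apply_eq (hij _ ⟨i, v, hv, rfl⟩)
    have key : ∀ i j, (∀ v ∈ F, S.h i v = S.h j v) → ∀ u t,
        σ.φ i (S.h i u) t → σ.φ j (S.h j u) t := by
      intro i j hij u t ht
      obtain ⟨h1, h2⟩ := h i j hij
      rwa [← S.h_apply_eq_of_inv_apply_eq (h2 _ _ ht), ← h1]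
    funext u t
    exact propext ⟨key i j hij' u t, key j i (fun v hv => (hij' v hv).symm) u t⟩
  φ_inj h h' := by
    rw [← σ.φ_inj h h', (S.h _).injective.eq_iff]
  φ_adj h h' := by
    rw [← σ.φ_adj h h', S.h_adj]
  φ_g {x y} h i := by
    obtain ⟨t, h1, h2⟩ := σ.φ_g h i
    refine ⟨S.f t, h2, ?_⟩
    simpa [Setting.dual] using h1
  gap {i u t x n} h1 h2 := by
    have h2' : σ.φ i x ((S.f⁻¹ ^ (n + 1)) t) := by simpa [Setting.dual] using h2
    refine (σ.gap (n := n) h2' ?_).symm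
    rw [inv_pow, show (S.f ^ (n + 1)) ((S.f ^ (n + 1))⁻¹ t) = t from
      RelIso.apply_symm_apply _ _]
    exact h1
  s_φ {i x t u t'} h1 h2 := by
    have h2' : σ.φ i u t' := by simpa [Setting.dual] using h2
    rw [σ.s_φ h2' h1, R.adj_comm, ← S.f_adj (S.dual.f t)]
    simp [Setting.dual]
  s_left u h := (σ.s_right u h).trans (R.adj_comm _ _)
  s_right x h := (σ.s_left x h).trans (R.adj_comm _ _)
  s_free {i u} h := by
    have : ¬ ∃ t, σ.φ i (S.h i (S.dual.h i u)) t := h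
    simpa [Setting.dual] using σ.s_free this

theorem le_dual_of_dual_le {σ : Approx S} {τ : Approx S.dual} (h : σ.dual ≤ τ) :
    σ ≤ (τ.dual : Approx S.dual.dual) := by
  refine ⟨fun _ _ => h.1 _ _, fun i x t hx => ?_⟩
  refine h.2 i _ t ?_
  simpa [dual, Setting.dual] using hx

/-! ### Enlarging the domains of the conjugating maps -/

/-- Add `x₀` to the domain of `φ i` for all `i ∈ C`, with an image `t₀ i` in a new infinite orbit
of `f`, and replace the promises `s` by `s'`. -/
def addPoint (σ : Approx S) (x₀ : V) (C : Set ι) (t₀ : ι → V) (s' : V → V → Prop)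
    (hdet : ∃ F : Set V, F.Finite ∧ ∀ i j, (∀ v ∈ F, S.h i v = S.h j v) →
      σ.φ i = σ.φ j ∧ (i ∈ C ↔ j ∈ C) ∧ (i ∈ C → t₀ i = t₀ j))
    (hnew : ∀ i ∈ C, ¬ ∃ t, σ.φ i x₀ t)
    (htype : ∀ i ∈ C, ∀ z w, σ.φ i z w → (R.Adj z x₀ ↔ R.Adj w (t₀ i)))
    (horb : ∀ i ∈ C, ∀ z w, σ.φ i z w → ∀ k : ℤ, (S.f ^ k) w ≠ t₀ i)
    (hN : ∀ i ∈ C, t₀ i ∉ S.N)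
    (hs : ∀ i x t u t', σ.φ i x t → σ.φ i (S.h i u) t' → (s' x u ↔ R.Adj (S.f t) t'))
    (hs_left : ∀ i ∈ C, ∀ u t', σ.φ i (S.h i u) t' → (s' x₀ u ↔ R.Adj (S.f (t₀ i)) t'))
    (hs_right : ∀ i ∈ C, ∀ x t, σ.φ i x t →
      (s' x ((S.h i)⁻¹ x₀) ↔ R.Adj (S.f t) (t₀ i)))
    (hs_self : ∀ i ∈ C, (s' x₀ ((S.h i)⁻¹ x₀) ↔ R.Adj (S.f (t₀ i)) (t₀ i)))
    (hleft : ∀ {x y} u, σ.g x y → (s' x u ↔ R.Adj y u))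
    (hright : ∀ {x y} x', σ.g x y → (s' x' y ↔ R.Adj x' x))
    (hfree : ∀ i u, (¬ ∃ t, σ.φ i (S.h i u) t) → (i ∈ C → S.h i u ≠ x₀) →
      (s' (S.h i u) u ↔ S.ε)) : Approx S where
  g := σ.g
  φ i z t := σ.φ i z t ∨ (i ∈ C ∧ z = x₀ ∧ t = t₀ i)
  s := s'
  φ_finite i := by
    refine ((σ.φ_finite i).union (finite_singleton (x₀, t₀ i))).subset ?_
    rintro ⟨z, t⟩ (h | ⟨-, rfl, rfl⟩)
    · exact .inl h
    · exact .inr rfl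
  φ_determined := by
    obtain ⟨F, hF, h⟩ := hdet
    refine ⟨F, hF, fun i j hij => ?_⟩
    obtain ⟨h1, h2, h3⟩ := h i j hij
    funext z t
    by_cases hi : i ∈ C
    · simp [h1, h2.1 hi, hi, h3 hi]
    · simp [h1, hi, mt h2.2 hi]
  φ_inj {i x t x' t'} h h' := by
    rcases h with h | ⟨hi, rfl, rfl⟩ <;> rcases h' with h' | ⟨hi', rfl, rfl⟩
    · exact σ.φ_inj h h'
    · exact iff_of_false (fun e => hnew i hi' ⟨t, e ▸ h⟩) (horb i hi' _ _ h 0)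
    · exact iff_of_false (fun e => hnew i hi ⟨t', e ▸ h'⟩) (horb i hi _ _ h' 0).symm
    · simp
  φ_adj {i x t x' t'} h h' := by
    rcases h with h | ⟨hi, rfl, rfl⟩ <;> rcases h' with h' | ⟨hi', rfl, rfl⟩
    · exact σ.φ_adj h h'
    · exact htype i hi' _ _ h
    · rw [R.adj_comm, htype i hi _ _ h', R.adj_comm]
    · simp
  φ_g h i := by
    obtain ⟨t, h1, h2⟩ := σ.φ_g h i
    exact ⟨t, .inl h1, .inl h2⟩
  gap {i x t u n} h h' := by
    rcases h with h | ⟨hi, rfl, rfl⟩ <;> rcases h' with h' | ⟨hi', e, e'⟩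
    · exact σ.gap h h'
    · exact absurd (by exact_mod_cast e') (horb i hi' _ _ h (n + 1 : ℕ))
    · refine absurd ?_ (horb i hi _ _ h' (-(n + 1 : ℕ)))
      rw [zpow_neg, zpow_natCast]
      exact RelIso.symm_apply_apply _ _
    · exact absurd (S.mem_N _ _ e') (hN i hi)
  s_φ {i x t u t'} h h' := by
    rcases h with h | ⟨hi, rfl, rfl⟩ <;> rcases h' with h' | ⟨hi', e, rfl⟩
    · exact hs i _ _ _ _ h h'
    · rw [← hs_right i hi' _ _ h, ← e, S.h_inv_h]
    · exact hs_left i hi _ _ h'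
    · rw [← hs_self i hi, ← e, S.h_inv_h]
  s_left := hleft
  s_right := hright
  s_free {i u} h := by
    refine hfree i u (fun ⟨t, ht⟩ => h ⟨t, .inl ht⟩) fun hi e => h ⟨t₀ i, .inr ⟨hi, e, rfl⟩⟩

/-- Types given by a relation `T w p`, demanding that the adjacency of `w` to the new vertex be
equivalent to `p`. -/
theorem exists_type_of_relation (S : Setting R ι) (T : V → Prop → Prop) {X : Set V}
    (hT : {w | ∃ p, T w p}.Finite) (hX : X.Finite)
    (hc : ∀ w p p', T w p → T w p' → (p ↔ p')) :
    ∃ v, (∀ w p, T w p → (R.Adj w v ↔ p)) ∧ (∀ w ∈ X, ∀ k : ℤ, (S.f ^ k) w ≠ v) ∧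
      (R.Adj v (S.f v) ↔ S.ε) := by
  obtain ⟨v, h1, h2, h3⟩ := S.exists_realizes ({w | ∃ p, T w p} ∪ X) (fun w => ∃ p, T w p ∧ p)
    (hT.union hX)
  refine ⟨v, fun w p h => ?_, fun w hw => h2 w (.inr hw), h3⟩
  rw [h1 w (.inl ⟨p, h⟩)]
  exact ⟨fun ⟨p', h', hp'⟩ => (hc w p p' h h').2 hp', fun hp => ⟨p, h, hp⟩⟩

theorem s_left_of_φ (σ : Approx S) (x₀ : V) {i z w u} (h : σ.φ i z w)
    (h' : σ.φ i (S.h i u) (S.f w)) : σ.s x₀ u ↔ R.Adj z x₀ := by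
  rw [σ.s_right _ (σ.g_of_φ h h'), R.adj_comm]

theorem s_right_of_φ (σ : Approx S) (x₀ : V) {i z t x} (h : σ.φ i x t)
    (h' : σ.φ i z (S.f t)) : σ.s x ((S.h i)⁻¹ x₀) ↔ R.Adj z x₀ := by
  rw [← S.h_h_inv i z] at h'
  rw [σ.s_left _ (σ.g_of_φ h h'), ← S.h_adj i, S.h_h_inv, S.h_h_inv]

theorem s_left_iff_s_right (σ : Approx S) (x₀ : V) {i u t x} (h : σ.φ i x t)
    (h' : σ.φ i (S.h i u) (S.f (S.f t))) : σ.s x₀ u ↔ σ.s x ((S.h i)⁻¹ x₀) := by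
  obtain ⟨⟨y, hy⟩, -⟩ := σ.gap (n := 1) h h'
  have := σ.φ_of_g hy h
  rw [σ.s_left_of_φ x₀ this h', σ.s_right_of_φ x₀ h this]

/-- The vertex `v` can serve as the image of `x₀` under `φ i`: it has the right adjacencies to the
range of `φ i`, its adjacencies to the preimage and the image of the range under `f` keep the
promises `s`, and it lies in a new orbit. -/
def Admissible (σ : Approx S) (x₀ : V) (i : ι) (v : V) : Prop :=
  (∀ z w, σ.φ i z w → (R.Adj w v ↔ R.Adj z x₀)) ∧
  (∀ u w, σ.φ i (S.h i u) (S.f w) → (R.Adj w v ↔ σ.s x₀ u)) ∧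
  (∀ x t, σ.φ i x t → (R.Adj (S.f t) v ↔ σ.s x ((S.h i)⁻¹ x₀))) ∧
  (R.Adj v (S.f v) ↔ S.ε) ∧ (∀ z w, σ.φ i z w → ∀ k : ℤ, (S.f ^ k) w ≠ v) ∧ v ∉ S.N

/-- The three kinds of adjacency demanded by `Admissible` may concern the same vertex, but they never
contradict each other, because by `gap` such a coincidence puts the vertices in question into the
domain or the range of `g`, where `s` is explicit. -/
theorem exists_admissible (σ : Approx S) (x₀ : V) (i : ι) : ∃ v, σ.Admissible x₀ i v := by
  have hr := σ.range_finite i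
  refine Exists.imp ?_ (exists_type_of_relation S
    (fun w p => (∃ z, σ.φ i z w ∧ (p ↔ R.Adj z x₀)) ∨
      (∃ u, σ.φ i (S.h i u) (S.f w) ∧ (p ↔ σ.s x₀ u)) ∨
      (∃ x t, σ.φ i x t ∧ w = S.f t ∧ (p ↔ σ.s x ((S.h i)⁻¹ x₀))))
    (X := {t | ∃ x, σ.φ i x t} ∪ S.N) ?_ (hr.union S.finite_N) ?_)
  · rintro v ⟨h1, h2, h3⟩
    refine ⟨fun z w h => h1 _ _ (.inl ⟨z, h, Iff.rfl⟩),
      fun u w h => h1 _ _ (.inr (.inl ⟨u, h, Iff.rfl⟩)),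
      fun x t h => h1 _ _ (.inr (.inr ⟨x, t, h, rfl, Iff.rfl⟩)), h3,
      fun z w h => h2 w (.inl ⟨z, h⟩), fun h => h2 v (.inr h) 0 rfl⟩
  · refine ((hr.union (hr.image fun w => S.f⁻¹ w)).union (hr.image S.f)).subset ?_
    rintro w ⟨p, ⟨z, h, -⟩ | ⟨u, h, -⟩ | ⟨x, t, h, rfl, -⟩⟩
    · exact .inl (.inl ⟨z, h⟩)
    · exact .inl (.inr ⟨_, ⟨_, h⟩, S.f_inv_f w⟩)
    · exact .inr ⟨t, ⟨x, h⟩, rfl⟩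
  · rintro w p p' (⟨z, h, e⟩ | ⟨u, h, e⟩ | ⟨x, t, h, e0, e⟩)
      (⟨z', h', e'⟩ | ⟨u', h', e'⟩ | ⟨x', t', h', e0', e'⟩) <;> rw [e, e']
    · rw [(σ.φ_inj h h').2 rfl]
    · rw [σ.s_left_of_φ x₀ h h']
    · subst e0'
      rw [σ.s_right_of_φ x₀ h' h]
    · rw [σ.s_left_of_φ x₀ h' h]
    · rw [(S.h i).injective ((σ.φ_inj h h').2 rfl)]
    · subst e0'
      exact σ.s_left_iff_s_right x₀ h' h
    · subst e0
      rw [σ.s_right_of_φ x₀ h h']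
    · subst e0
      exact (σ.s_left_iff_s_right x₀ h h').symm
    · rw [(σ.φ_inj h h').2 (S.f.injective (e0.symm.trans e0'))]

theorem admissible_congr (σ : Approx S) {x₀ : V} {i j : ι} (hφ : σ.φ i = σ.φ j)
    (hinv : ∀ x, x = x₀ ∨ (∃ t, σ.φ i x t) → (S.h i)⁻¹ x = (S.h j)⁻¹ x) :
    σ.Admissible x₀ i = σ.Admissible x₀ j := by
  have h1 : ∀ u w, σ.φ j (S.h i u) w ↔ σ.φ j (S.h j u) w := by
    intro u w
    constructor <;> intro h
    · rwa [← S.h_apply_eq_of_inv_apply_eq (hinv _ (.inr ⟨w, hφ ▸ h⟩))]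
    · rwa [← S.h_apply_eq_of_inv_apply_eq (hinv _ (.inr ⟨w, hφ ▸ h⟩)).symm]
  funext v
  simp only [Admissible, hφ, h1, hinv x₀ (.inl rfl)]

/-- Every vertex can be added to the domains of all the maps `φ i`. -/
theorem exists_domain (σ : Approx S) (x₀ : V) : ∃ τ, σ ≤ τ ∧ ∀ i, ∃ t, τ.φ i x₀ t := by
  obtain ⟨F, hF, h⟩ := σ.exists_strongly_determined
  have : Nonempty V := ⟨x₀⟩
  -- `epsilon` makes the choice for `i` depend on the predicate `Admissible x₀ i` alone, hence on a
  -- finite part of `h i`.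
  let t₀ : ι → V := fun i => Classical.epsilon (σ.Admissible x₀ i)
  have ht : ∀ i, σ.Admissible x₀ i (t₀ i) := fun i =>
    Classical.epsilon_spec (σ.exists_admissible x₀ i)
  refine ⟨σ.addPoint x₀ {i | ¬ ∃ t, σ.φ i x₀ t} t₀ σ.s ?_ (fun i hi => hi)
    (fun i _ z w hz => ((ht i).1 z w hz).symm) (fun i _ => (ht i).2.2.2.2.1)
    (fun i _ => (ht i).2.2.2.2.2) (fun i x t u t' => σ.s_φ) ?_ ?_ ?_ σ.s_left σ.s_right
    (fun i u hu _ => σ.s_free hu), ⟨fun _ _ => id, fun _ _ _ => .inl⟩, fun i => ?_⟩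
  · refine ⟨F ∪ _, hF.union (S.finite_image_inv (finite_singleton x₀)), fun i j hij => ?_⟩
    obtain ⟨h1, h2⟩ := h i j fun v hv => hij v (.inl hv)
    have hx₀ : (S.h i)⁻¹ x₀ = (S.h j)⁻¹ x₀ :=
      S.inv_apply_eq_of_h_apply_eq (hij _ (.inr ⟨i, x₀, rfl, rfl⟩))
    refine ⟨h1, by simp [h1], fun _ => ?_⟩
    have : σ.Admissible x₀ i = σ.Admissible x₀ j := by
      refine σ.admissible_congr h1 ?_
      rintro x (rfl | ⟨t, ht⟩)
      · exact hx₀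
      · exact h2 x t ht
    simp only [t₀, this]
  · intro i _ u t' hu
    rw [← S.f_f_inv t', S.f_adj, R.adj_comm]
    exact ((ht i).2.1 u _ (by rwa [S.f_f_inv])).symm
  · intro i _ x t hx
    exact ((ht i).2.2.1 x t hx).symm
  · intro i hi
    rw [R.adj_comm, (ht i).2.2.2.1]
    have := σ.s_free (i := i) (u := (S.h i)⁻¹ x₀) (by simpa using hi)
    rwa [S.h_h_inv] at this
  · by_cases hi : ∃ t, σ.φ i x₀ t
    · exact ⟨_, .inl hi.choose_spec⟩
    · exact ⟨_, .inr ⟨hi, rfl, rfl⟩⟩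

/-! ### Enlarging the ranges of the conjugating maps -/

open Classical in
/-- A vertex `t₀` in a new infinite orbit can be added to the range of `φ i` for all `i` in a class
of indices with the same `φ i` and the same preimage of its domain under `h i`. The new element
`x₀` of the domain is so generic that `(h i)⁻¹ x₀` determines the class of `i`. Hence the promises
which the arbitrary vertex `t₀` forces upon `x₀` and `(h i)⁻¹ x₀` do not concern the other
classes. -/
theorem exists_range_class (σ : Approx S) {F : Set V} (hF : F.Finite) (i₀ : ι) (t₀ : V)
    (hdet : ∀ i, (∀ v ∈ F, S.h i v = S.h i₀ v) →
      σ.φ i = σ.φ i₀ ∧ ∀ x t, σ.φ i₀ x t → (S.h i)⁻¹ x = (S.h i₀)⁻¹ x)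
    (hN : t₀ ∉ S.N) (horb : ∀ z w, σ.φ i₀ z w → ∀ k : ℤ, (S.f ^ k) w ≠ t₀) :
    ∃ τ, σ ≤ τ ∧ (∀ i, (∀ v ∈ F, S.h i v = S.h i₀ v) → ∃ x, τ.φ i x t₀) ∧
      ∀ i, ¬ (∀ v ∈ F, S.h i v = S.h i₀ v) → τ.φ i = σ.φ i := by
  obtain ⟨x₀, htype, hfresh, hsplit⟩ := S.dual.exists_type_splits
    (M := {x | ∃ t, σ.φ i₀ x t})
    (fun z => ∃ w, σ.φ i₀ z w ∧ R.Adj w t₀)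
    (X := {w | ∃ i, ∃ x ∈ {w | ∃ j, ∃ x ∈ {x | ∃ k t, σ.φ k x t}, (S.h j)⁻¹ x = w}, S.h i x = w})
    (F := {w | ∃ i, ∃ x ∈ F, S.h i x = w})
    (σ.domain_finite.subset fun x hx => ⟨i₀, hx⟩)
    (S.finite_image (S.finite_image_inv σ.domain_finite)) (S.finite_image hF)
  have hfresh' : ∀ {i j k t}, ¬ σ.φ k (S.h j ((S.h i)⁻¹ x₀)) t := fun {i j k t} h =>
    hfresh ⟨i, _, ⟨j, _, ⟨k, t, h⟩, rfl⟩, by simp⟩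
  have hfresh₀ : ∀ {k t}, ¬ σ.φ k x₀ t := fun {k t} h =>
    hfresh' (i := k) (j := k) (k := k) (t := t) (by rwa [S.h_h_inv])
  have hsplit' : ∀ i j, (S.h i)⁻¹ x₀ = (S.h j)⁻¹ x₀ → ∀ v ∈ F, S.h i v = S.h j v := by
    intro i j hij v hv
    exact (S.h_apply_eq_of_inv_apply_eq (hsplit i j hij _ ⟨j, v, hv, rfl⟩).symm).symm
  have htype' : ∀ z w, σ.φ i₀ z w → (R.Adj z x₀ ↔ R.Adj w t₀) := by
    intro z w h
    rw [htype z ⟨w, h⟩]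
    exact ⟨fun ⟨w', h', hw'⟩ => (σ.φ_inj h h').1 rfl ▸ hw', fun hw => ⟨w, h, hw⟩⟩
  set C : Set ι := {i | ∀ v ∈ F, S.h i v = S.h i₀ v} with hC
  have hpre : ∀ i ∈ C, ∀ {u t}, σ.φ i (S.h i u) t ↔ σ.φ i₀ (S.h i₀ u) t := by
    intro i hi u t
    obtain ⟨h1, h2⟩ := hdet i hi
    rw [h1]
    constructor <;> intro h
    · rwa [← S.h_apply_eq_of_inv_apply_eq (h2 _ _ h)]
    · rwa [← S.h_apply_eq_of_inv_apply_eq (h2 _ _ h).symm]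
  -- The pairs with `x₀` as first or some `(h j)⁻¹ x₀` as second entry get the values which `t₀`
  -- forces upon them; all others keep theirs.
  let s' : V → V → Prop := fun x u =>
    if x = x₀ then
      if ∃ j ∈ C, (S.h j)⁻¹ x₀ = u then R.Adj (S.f t₀) t₀
      else if ∃ w, σ.φ i₀ (S.h i₀ u) w then ∃ w, σ.φ i₀ (S.h i₀ u) w ∧ R.Adj (S.f t₀) w
      else S.ε
    else
      if (∃ j ∈ C, (S.h j)⁻¹ x₀ = u) ∧ ∃ t, σ.φ i₀ x t then
        ∃ t, σ.φ i₀ x t ∧ R.Adj (S.f t) t₀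
      else σ.s x u
  have hs_old : ∀ x u, x ≠ x₀ → (∀ j ∈ C, (S.h j)⁻¹ x₀ ≠ u) → (s' x u ↔ σ.s x u) := by
    intro x u hx hu
    simp only [s', if_neg hx]
    rw [if_neg]
    rintro ⟨⟨j, hj, e⟩, -⟩
    exact hu j hj e
  have hs_x₀ : ∀ u w, σ.φ i₀ (S.h i₀ u) w → (s' x₀ u ↔ R.Adj (S.f t₀) w) := by
    intro u w h
    simp only [s', if_true]
    rw [if_neg, if_pos ⟨w, h⟩]
    · exact ⟨fun ⟨w', h', hw'⟩ => (σ.φ_inj h h').1 rfl ▸ hw', fun hw => ⟨w, h, hw⟩⟩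
    · rintro ⟨j, hj, rfl⟩
      exact hfresh' h
  have hs_u : ∀ j ∈ C, ∀ x t, σ.φ i₀ x t → (s' x ((S.h j)⁻¹ x₀) ↔ R.Adj (S.f t) t₀) := by
    intro j hj x t h
    have hx : x ≠ x₀ := by rintro rfl; exact hfresh₀ h
    simp only [s', if_neg hx]
    rw [if_pos ⟨⟨j, hj, rfl⟩, t, h⟩]
    exact ⟨fun ⟨w', h', hw'⟩ => (σ.φ_inj h h').1 rfl ▸ hw', fun hw => ⟨t, h, hw⟩⟩
  have hs_self : ∀ j ∈ C, (s' x₀ ((S.h j)⁻¹ x₀) ↔ R.Adj (S.f t₀) t₀) := by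
    intro j hj
    simp only [s', if_true]
    rw [if_pos ⟨j, hj, rfl⟩]
  refine ⟨σ.addPoint x₀ C (fun _ => t₀) s' ?_ (fun i _ ⟨t, h⟩ => hfresh₀ h)
    (fun i hi z w h => htype' z w ((hdet i hi).1 ▸ h))
    (fun i hi z w h => horb z w ((hdet i hi).1 ▸ h)) (fun _ _ => hN) ?_
    (fun i hi u t' h => hs_x₀ u t' ((hpre i hi).1 h))
    (fun i hi x t h => hs_u i hi x t ((hdet i hi).1 ▸ h)) hs_self ?_ ?_ ?_,
    ⟨fun _ _ => id, fun _ _ _ => .inl⟩, fun i hi => ⟨x₀, .inr ⟨hi, rfl, rfl⟩⟩, fun i hi => ?_⟩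
  · obtain ⟨F', hF', h⟩ := σ.φ_determined
    refine ⟨F ∪ F', hF.union hF', fun i j hij => ⟨h i j fun v hv => hij v (.inr hv), ?_,
      fun _ => rfl⟩⟩
    exact forall₂_congr fun v hv => by rw [hij v (.inl hv)]
  · intro i x t u t' h h'
    rw [hs_old, σ.s_φ h h']
    · rintro rfl
      exact hfresh₀ h
    · rintro j - rfl
      exact hfresh' h'
  · intro x y u hg
    obtain ⟨t, h1, h2⟩ := σ.φ_g hg i₀
    have hx : x ≠ x₀ := by rintro rfl; exact hfresh₀ h1
    by_cases hu : ∃ j ∈ C, (S.h j)⁻¹ x₀ = u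
    · obtain ⟨j, hj, rfl⟩ := hu
      rw [hs_u j hj x t h1, ← htype' _ _ ((hdet j hj).1 ▸ (hpre j hj).2 h2), S.adj_h_left]
    · rw [hs_old _ _ hx fun j hj e => hu ⟨j, hj, e⟩, σ.s_left u hg]
  · intro x y x' hg
    obtain ⟨t, h1, h2⟩ := σ.φ_g hg i₀
    by_cases hx : x' = x₀
    · subst hx
      rw [hs_x₀ y _ h2, S.f_adj, R.adj_comm, R.adj_comm x', htype' _ _ h1]
    · rw [hs_old _ _ hx, σ.s_right x' hg]
      rintro j - rfl
      exact hfresh' h2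
  · intro i u h hi
    by_cases hx : S.h i u = x₀
    · have hu : u = (S.h i)⁻¹ x₀ := by rw [← hx, S.h_inv_h]
      rw [hx]
      simp only [s', if_true]
      rw [if_neg, if_neg]
      · rintro ⟨w, hw⟩
        rw [hu] at hw
        exact hfresh' hw
      · rintro ⟨j, hj, e⟩
        refine hi (fun v hv => ?_) hx
        rw [← hj v hv, hsplit' j i (e.trans hu) v hv]
    · have : s' (S.h i u) u ↔ σ.s (S.h i u) u := by
        simp only [s', if_neg hx]
        rw [if_neg]
        rintro ⟨⟨j, hj, rfl⟩, t, ht⟩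
        exact hfresh' ht
      rw [this, σ.s_free h]
  · funext x t
    refine propext ⟨fun h => h.resolve_right fun h' => hi h'.1, .inl⟩

/-- For all `i`, the orbit of a given vertex outside of `N` can be made to meet the range of
`φ i`. The finitely many classes of indices are treated one after the other. -/
theorem exists_range (σ : Approx S) (t₀ : V) (hN : t₀ ∉ S.N) :
    ∃ τ, σ ≤ τ ∧ ∀ i, ∃ x w, τ.φ i x w ∧ ∃ k : ℤ, (S.f ^ k) w = t₀ := by
  obtain ⟨F, hF, hdet⟩ := σ.exists_strongly_determined
  obtain ⟨J, hJ, hrep⟩ := S.exists_finite_representatives hF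
  suffices ∃ τ, σ ≤ τ ∧
      (∀ i, (∃ j ∈ J, ∀ v ∈ F, S.h i v = S.h j v) →
        ∃ x w, τ.φ i x w ∧ ∃ k : ℤ, (S.f ^ k) w = t₀) ∧
      ∀ i, (¬ ∃ j ∈ J, ∀ v ∈ F, S.h i v = S.h j v) → τ.φ i = σ.φ i by
    obtain ⟨τ, h1, h2, -⟩ := this
    exact ⟨τ, h1, fun i => h2 i (hrep i)⟩
  clear hrep
  induction J, hJ using Set.Finite.induction_on with
  | empty => exact ⟨σ, le_rfl, by simp, by simp⟩
  | @insert j J _ _ ih =>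
    obtain ⟨τ, h1, h2, h3⟩ := ih
    by_cases hj : (∃ j' ∈ J, ∀ v ∈ F, S.h j v = S.h j' v) ∨
        ∃ x w, σ.φ j x w ∧ ∃ k : ℤ, (S.f ^ k) w = t₀
    · refine ⟨τ, h1, ?_, fun i hi => h3 i fun ⟨j', hj', e⟩ => hi ⟨j', .inr hj', e⟩⟩
      rintro i ⟨j', rfl | hj', e⟩
      · rcases hj with ⟨j'', hj'', e'⟩ | ⟨x, w, hx, hw⟩
        · exact h2 i ⟨j'', hj'', fun v hv => (e v hv).trans (e' v hv)⟩
        · exact ⟨x, w, h1.2 _ _ _ ((hdet i j' e).1 ▸ hx), hw⟩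
      · exact h2 i ⟨j', hj', e⟩
    · push Not at hj
      obtain ⟨hj1, hj2⟩ := hj
      have hτ : ∀ i, (∀ v ∈ F, S.h i v = S.h j v) → τ.φ i = σ.φ i := by
        rintro i hi
        refine h3 i ?_
        rintro ⟨j', hj', e⟩
        obtain ⟨v, hv, hne⟩ := hj1 j' hj'
        exact hne ((hi v hv).symm.trans (e v hv))
      obtain ⟨τ', h1', h2', h3'⟩ := τ.exists_range_class hF j t₀ (fun i hi => by
        rw [hτ i hi, hτ j fun _ _ => rfl]
        exact ⟨(hdet i j hi).1, fun x t hx => (hdet i j hi).2 x t ((hdet i j hi).1 ▸ hx)⟩) hN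
        (fun z w h => by rw [hτ j fun _ _ => rfl] at h; exact hj2 z w h)
      refine ⟨τ', h1.trans h1', ?_, fun i hi => ?_⟩
      · rintro i ⟨j', rfl | hj', e⟩
        · obtain ⟨x, hx⟩ := h2' i e
          exact ⟨x, t₀, hx, 0, rfl⟩
        · obtain ⟨x, w, hx, hw⟩ := h2 i ⟨j', hj', e⟩
          exact ⟨x, w, h1'.2 _ _ _ hx, hw⟩
      · rw [h3' i fun e => hi ⟨j, .inl rfl, e⟩]
        exact h3 i fun ⟨j', hj', e⟩ => hi ⟨j', .inr hj', e⟩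

/-! ### Extending the common factor -/

open Classical in
/-- If `x₀` lies in the domain of every `φ i`, then `g` can be defined at `x₀`. Its value `y` is
adjacent to those vertices that `s x₀` demands. Then `φ i (h i y) = f (φ i x₀)` is forced, and with
it the promises about `h i y`. These are consistent since `y` is so generic that `h i y` determines
`φ i` and the preimage of its domain under `h i`. -/
theorem exists_extend [Nonempty ι] (σ : Approx S) (x₀ : V) (t₀ : ι → V) (ht₀ : ∀ i, σ.φ i x₀ (t₀ i))
    (hg : ¬ ∃ y, σ.g x₀ y) : ∃ τ, σ ≤ τ ∧ ∃ y, τ.g x₀ y := by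
  obtain ⟨F, hF, hdet⟩ := σ.exists_strongly_determined
  obtain ⟨y, htype, hfresh, hsplit⟩ := S.exists_type_splits
    (M := {w | ∃ i, ∃ x ∈ {x | ∃ k t, σ.φ k x t}, (S.h i)⁻¹ x = w})
    (fun u => σ.s x₀ u)
    (X := {w | ∃ i, ∃ x ∈ {w | ∃ i, ∃ x ∈ {w | ∃ j, ∃ x ∈ {x | ∃ k t, σ.φ k x t},
      (S.h j)⁻¹ x = w}, S.h i x = w}, (S.h i)⁻¹ x = w})
    (S.finite_image_inv σ.domain_finite)
    (S.finite_image_inv (S.finite_image (S.finite_image_inv σ.domain_finite))) hF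
  have hfresh' : ∀ {i j k l t}, ¬ σ.φ l (S.h k ((S.h j)⁻¹ (S.h i y))) t := fun {i j k l t} h =>
    hfresh ⟨i, _, ⟨j, _, ⟨k, _, ⟨l, t, h⟩, rfl⟩, rfl⟩, by simp⟩
  have hy : ∀ {i k t}, ¬ σ.φ k (S.h i y) t := fun {i k t} h =>
    hfresh' (i := i) (j := i) (k := i) (l := k) (t := t) (by rwa [S.h_inv_h])
  have htype' : ∀ {i u t}, σ.φ i (S.h i u) t → (R.Adj u y ↔ σ.s x₀ u) := fun {i u t} h =>
    htype u ⟨i, _, ⟨i, t, h⟩, S.h_inv_h i u⟩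
  have hx₀ : ∀ {i}, x₀ ≠ S.h i y := fun {i} h => hy (i := i) (k := i) (h ▸ ht₀ i)
  have hft : ∀ {i x}, ¬ σ.φ i x (S.f (t₀ i)) := fun {i x} h => by
    rw [← S.h_h_inv i x] at h
    exact hg ⟨_, σ.g_of_φ (ht₀ i) h⟩
  have hadj : ∀ {i x t}, σ.φ i x t → (R.Adj x (S.h i y) ↔ R.Adj t (S.f (t₀ i))) := by
    intro i x t h
    rw [← S.h_h_inv i x] at h
    rw [← S.h_h_inv i x, S.h_adj, htype' h, σ.s_φ (ht₀ i) h, R.adj_comm]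
  have htwin : ∀ {i j u t}, S.h i y = S.h j y → σ.φ i (S.h i u) t →
      σ.φ j (S.h j u) t ∧ t₀ i = t₀ j := by
    intro i j u t hij h
    obtain ⟨h1, h2⟩ := hdet i j (hsplit i j hij)
    exact ⟨by rwa [← S.h_apply_eq_of_inv_apply_eq (h2 _ _ h), ← h1],
      (σ.φ_inj (ht₀ i) (h1 ▸ ht₀ j)).1 rfl⟩
  have hgy : ∀ {x z}, σ.g x z → (R.Adj z y ↔ R.Adj x₀ x) := by
    intro x z h
    obtain ⟨t, -, h2⟩ := σ.φ_g h (Classical.arbitrary ι)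
    rw [htype' h2, σ.s_right x₀ h]
  -- `P x u` says that the promise about `x` and `u` is forced by the values `φ i (h i y)`.
  let P : V → V → Prop := fun x u => ∃ i t, x = S.h i y ∧ σ.φ i (S.h i u) t
  let s' : V → V → Prop := fun x u =>
    if x = x₀ then R.Adj y u
    else if u = y then R.Adj x x₀
    else if P x u then ∃ i t, x = S.h i y ∧ σ.φ i (S.h i u) t ∧ R.Adj (S.f (S.f (t₀ i))) t
    else σ.s x u
  have hs_x₀ : ∀ u, s' x₀ u ↔ R.Adj y u := fun u => by simp [s']
  have hs_y : ∀ x, s' x y ↔ R.Adj x x₀ := fun x => by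
    by_cases hx : x = x₀ <;> simp [s', hx]
  have hs_P : ∀ i u t, σ.φ i (S.h i u) t →
      (s' (S.h i y) u ↔ R.Adj (S.f (S.f (t₀ i))) t) := by
    intro i u t h
    have hu : u ≠ y := by rintro rfl; exact hy h
    simp only [s', if_neg hx₀.symm, if_neg hu]
    rw [if_pos ⟨i, t, rfl, h⟩]
    refine ⟨fun ⟨j, t', h1, h2, h3⟩ => ?_, fun h3 => ⟨i, t, rfl, h, h3⟩⟩
    obtain ⟨h4, h5⟩ := htwin h1.symm h2
    rwa [(σ.φ_inj h h4).1 rfl, ← h5]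
  have hs_old : ∀ x u, x ≠ x₀ → u ≠ y → (¬ P x u) → (s' x u ↔ σ.s x u) := by
    intro x u h1 h2 h3
    simp only [s', if_neg h1, if_neg h2, if_neg h3]
  have hP : ∀ {i x u t}, σ.φ i x t → ¬ P x u := by
    rintro i x u t h ⟨j, t', rfl, -⟩
    exact hy h
  have hadj' : ∀ {i x t x' t'}, (σ.φ i x t ∨ x = S.h i y ∧ t = S.f (t₀ i)) →
      (σ.φ i x' t' ∨ x' = S.h i y ∧ t' = S.f (t₀ i)) → (R.Adj x x' ↔ R.Adj t t') := by
    rintro i x t x' t' (h | ⟨rfl, rfl⟩) (h' | ⟨rfl, rfl⟩)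
    · exact σ.φ_adj h h'
    · exact hadj h
    · rw [R.adj_comm, hadj h', R.adj_comm]
    · simp
  let τ : Approx S :=
    { g := fun a b => σ.g a b ∨ (a = x₀ ∧ b = y)
      φ := fun i a b => σ.φ i a b ∨ (a = S.h i y ∧ b = S.f (t₀ i))
      s := s'
      φ_finite := fun i => by
        refine ((σ.φ_finite i).union (finite_singleton (S.h i y, S.f (t₀ i)))).subset ?_
        rintro ⟨z, t⟩ (h | ⟨rfl, rfl⟩)
        · exact .inl h
        · exact .inr rfl
      φ_determined := by
        refine ⟨insert y F, hF.insert y, fun i j hij => ?_⟩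
        have h1 := (hdet i j fun v hv => hij v (.inr hv)).1
        have h2 : t₀ i = t₀ j := (σ.φ_inj (ht₀ i) (h1 ▸ ht₀ j)).1 rfl
        funext a b
        rw [h1, h2, hij y (.inl rfl)]
      φ_inj := by
        rintro i x t x' t' (h | ⟨rfl, rfl⟩) (h' | ⟨rfl, rfl⟩)
        · exact σ.φ_inj h h'
        · exact iff_of_false (fun e => hy (e ▸ h)) (fun e => hft (e ▸ h))
        · exact iff_of_false (fun e => hy (e ▸ h')) (fun e => hft (e ▸ h'))
        · simp
      φ_adj := hadj'
      φ_g := by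
        rintro x z (h | ⟨rfl, rfl⟩) i
        · obtain ⟨t, h1, h2⟩ := σ.φ_g h i
          exact ⟨t, .inl h1, .inl h2⟩
        · exact ⟨t₀ i, .inl (ht₀ i), .inr ⟨rfl, rfl⟩⟩
      gap := by
        rintro i x t u n (h | ⟨rfl, rfl⟩) (h' | ⟨e, e'⟩)
        · obtain ⟨⟨a, ha⟩, b, hb⟩ := σ.gap h h'
          exact ⟨⟨a, .inl ha⟩, b, .inl hb⟩
        · obtain rfl := (S.h i).injective e
          refine ⟨?_, x₀, .inr ⟨rfl, rfl⟩⟩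
          rw [S.f_pow_succ, S.f.injective.eq_iff] at e'
          rcases n with _ | n
          · have : t = t₀ i := e'
            exact ⟨u, .inr ⟨(σ.φ_inj h (ht₀ i)).2 this, rfl⟩⟩
          · have h0 := ht₀ i
            rw [← e', ← S.h_h_inv i x₀] at h0
            obtain ⟨⟨a, ha⟩, -⟩ := σ.gap h h0
            exact ⟨a, .inl ha⟩
        · rw [← S.f_pow_succ'] at h'
          exact absurd (σ.gap (ht₀ i) h').1 hg
        · rw [← S.f_pow_succ', S.f_pow_succ, S.f.injective.eq_iff] at e'
          have h0 := ht₀ i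
          rw [← e', ← S.h_h_inv i x₀] at h0
          exact absurd (σ.gap (ht₀ i) h0).1 hg
      s_φ := by
        rintro i x t u t' (h | ⟨rfl, rfl⟩) (h' | ⟨e, rfl⟩)
        · by_cases hx : x = x₀
          · subst hx
            rw [hs_x₀, R.adj_comm, htype' h', σ.s_φ h h']
          · rw [hs_old _ _ hx (by rintro rfl; exact hy h') (hP h), σ.s_φ h h']
        · obtain rfl := (S.h i).injective e
          rw [hs_y, S.f_adj, σ.φ_adj h (ht₀ i)]
        · exact hs_P i u t' h'
        · obtain rfl := (S.h i).injective e
          rw [hs_y, S.f_adj]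
          exact hadj' (.inr ⟨rfl, rfl⟩) (.inl (ht₀ i))
      s_left := by
        rintro x z u (h | ⟨rfl, rfl⟩)
        · by_cases hx : x = x₀
          · exact absurd ⟨z, hx ▸ h⟩ hg
          by_cases hu : u = y
          · subst hu
            rw [hs_y, hgy h, R.adj_comm]
          · rw [hs_old _ _ hx hu, σ.s_left u h]
            rintro ⟨j, t', rfl, -⟩
            obtain ⟨t, h1, -⟩ := σ.φ_g h j
            exact hy h1
        · exact hs_x₀ u
      s_right := by
        rintro x z x' (h | ⟨rfl, rfl⟩)
        · by_cases hx : x' = x₀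
          · subst hx
            rw [hs_x₀, R.adj_comm, hgy h]
          · have hz : z ≠ y := by
              rintro rfl
              obtain ⟨t, -, h2⟩ := σ.φ_g h (Classical.arbitrary ι)
              exact hy h2
            by_cases hx' : ∃ j, x' = S.h j y
            · obtain ⟨j, rfl⟩ := hx'
              obtain ⟨t, h1, h2⟩ := σ.φ_g h j
              rw [hs_P j z _ h2, S.f_adj, R.adj_comm, ← hadj h1, R.adj_comm]
            · rw [hs_old _ _ hx hz fun ⟨j, t, e, _⟩ => hx' ⟨j, e⟩, σ.s_right x' h]
        · exact hs_y x'
      s_free := by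
        intro i u h
        have h1 : ¬ ∃ t, σ.φ i (S.h i u) t := fun ⟨t, ht⟩ => h ⟨t, .inl ht⟩
        have h2 : u ≠ y := by rintro rfl; exact h ⟨_, .inr ⟨rfl, rfl⟩⟩
        have h3 : S.h i u ≠ x₀ := fun e => h1 ⟨t₀ i, e ▸ ht₀ i⟩
        rw [hs_old _ _ h3 h2, σ.s_free h1]
        rintro ⟨j, t', e, h'⟩
        rw [← S.h_inv_h i u, e] at h'
        exact hfresh' h' }
  exact ⟨τ, ⟨fun _ _ => .inl, fun _ _ _ => .inl⟩, y, .inr ⟨rfl, rfl⟩⟩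

theorem exists_image [Nonempty ι] (σ : Approx S) (x₀ : V) : ∃ τ, σ ≤ τ ∧ ∃ y, τ.g x₀ y := by
  obtain ⟨σ', h, h'⟩ := σ.exists_domain x₀
  choose t₀ ht₀ using h'
  by_cases hg : ∃ y, σ'.g x₀ y
  · exact ⟨σ', h, hg⟩
  · obtain ⟨τ, hτ, hy⟩ := σ'.exists_extend x₀ t₀ ht₀ hg
    exact ⟨τ, h.trans hτ, hy⟩

/-- This is `exists_image` in the dual setting. -/
theorem exists_preimage [Nonempty ι] (σ : Approx S) (y₀ : V) :
    ∃ τ, σ ≤ τ ∧ ∃ x, τ.g x y₀ := by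
  obtain ⟨τ, h, x, hx⟩ := σ.dual.exists_image y₀
  exact ⟨(τ.dual : Approx S.dual.dual), le_dual_of_dual_le h, x, hx⟩

theorem exists_step [Nonempty ι] (σ : Approx S) (v : V) :
    ∃ τ, σ ≤ τ ∧ (∃ y, τ.g v y) ∧ (∃ x, τ.g x v) ∧
      (v ∉ S.N → ∀ i, ∃ x w, τ.φ i x w ∧ ∃ k : ℤ, (S.f ^ k) w = v) := by
  obtain ⟨σ₁, h₁, y, hy⟩ := σ.exists_image v
  obtain ⟨σ₂, h₂, x, hx⟩ := σ₁.exists_preimage v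
  by_cases hv : v ∈ S.N
  · exact ⟨σ₂, h₁.trans h₂, ⟨y, h₂.1 _ _ hy⟩, ⟨x, hx⟩, fun h => absurd hv h⟩
  · obtain ⟨σ₃, h₃, h⟩ := σ₂.exists_range v hv
    exact ⟨σ₃, (h₁.trans h₂).trans h₃, ⟨y, h₃.1 _ _ (h₂.1 _ _ hy)⟩, ⟨x, h₃.1 _ _ hx⟩,
      fun _ => h⟩

end Approx

/-! ### The limit of the approximations -/

/-- A total and surjective relation preserving equality and adjacency is an automorphism. -/
theorem exists_iso_of_relation (G : V → V → Prop) (htot : ∀ x, ∃ y, G x y)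
    (hsurj : ∀ y, ∃ x, G x y) (hinj : ∀ {x y x' y'}, G x y → G x' y' → (x = x' ↔ y = y'))
    (hadj : ∀ {x y x' y'}, G x y → G x' y' → (R.Adj x x' ↔ R.Adj y y')) :
    ∃ e : R ≃g R, ∀ x y, G x y ↔ e x = y := by
  choose a ha using htot
  choose b hb using hsurj
  refine ⟨⟨⟨a, b, fun x => (hinj (hb _) (ha x)).2 rfl, fun y => (hinj (ha _) (hb y)).1 rfl⟩,
    (hadj (ha _) (ha _)).symm⟩, fun x y => ⟨fun h => (hinj (ha x) h).1 rfl, ?_⟩⟩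
  rintro rfl
  exact ha x

namespace Setting

variable (S : Setting R ι)

/-- The approximation in which `g` and all `φ i` are the identity on `N`. -/
def identityApprox (hf : ∀ v, S.f v ∈ S.N ↔ v ∈ S.N) (hh : ∀ i, ∀ v ∈ S.N, S.h i v = S.f v) :
    Approx S :=
  have hhN : ∀ i v, S.h i v ∈ S.N ↔ v ∈ S.N := by
    intro i v
    constructor <;> intro h
    · have h1 : S.f⁻¹ (S.h i v) ∈ S.N := by rwa [← hf, S.f_f_inv]
      have h2 := hh i _ h1
      rw [S.f_f_inv] at h2
      rwa [(S.h i).injective h2] at h1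
    · rw [hh i v h, hf]; exact h
  { g x y := x ∈ S.N ∧ y = x
    φ _ x y := x ∈ S.N ∧ y = x
    s x u := (x ∈ S.N ∨ u ∈ S.N) ∧ R.Adj x u ∨ (x ∉ S.N ∧ u ∉ S.N) ∧ S.ε
    φ_finite i := by
      refine (S.finite_N.image fun x => (x, x)).subset ?_
      rintro ⟨x, y⟩ ⟨hx, rfl : y = x⟩
      exact ⟨y, hx, rfl⟩
    φ_determined := ⟨∅, finite_empty, fun _ _ _ => rfl⟩
    φ_inj := by rintro i x t x' t' ⟨-, rfl⟩ ⟨-, rfl⟩; rfl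
    φ_adj := by rintro i x t x' t' ⟨-, rfl⟩ ⟨-, rfl⟩; rfl
    φ_g := by
      rintro x y ⟨hx, rfl⟩ i
      exact ⟨y, ⟨hx, rfl⟩, (hhN i y).2 hx, (hh i y hx).symm⟩
    gap := by
      rintro i x t u n ⟨hx, rfl⟩ ⟨hu, -⟩
      exact ⟨⟨_, hx, rfl⟩, u, (hhN i u).1 hu, rfl⟩
    s_φ := by
      rintro i x t u t' ⟨hx, rfl⟩ ⟨hu, rfl⟩
      rw [hhN] at hu
      rw [← hh i t hx, S.h_adj]
      simp [hx]
    s_left := by rintro x y u ⟨hx, rfl⟩; simp [hx]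
    s_right := by rintro x y x' ⟨hx, rfl⟩; simp [hx]
    s_free := by
      intro i u h
      have h1 : S.h i u ∉ S.N := fun h1 => h ⟨_, h1, rfl⟩
      have h2 : u ∉ S.N := fun h2 => h1 ((hhN i u).2 h2)
      simp [h1, h2] }

/-- The union of a directed family of approximations meeting all the requirements of
`Approx.exists_step` solves the conjugation problem. -/
theorem exists_conjugations [Countable V] [Nonempty ι] (hf : ∀ v, S.f v ∈ S.N ↔ v ∈ S.N)
    (hh : ∀ i, ∀ v ∈ S.N, S.h i v = S.f v) :
    ∃ (g : R ≃g R) (φ : ι → (R ≃g R)), (∀ v ∈ S.N, g v = v) ∧ (∀ i, ∀ v ∈ S.N, φ i v = v) ∧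
      ∀ i, φ i * S.h i * g = S.f * φ i := by
  have := Encodable.ofCountable V
  let D : V → Order.Cofinal (Approx S) := fun v =>
    { carrier := {τ | (∃ y, τ.g v y) ∧ (∃ x, τ.g x v) ∧
        (v ∉ S.N → ∀ i, ∃ x w, τ.φ i x w ∧ ∃ k : ℤ, (S.f ^ k) w = v)}
      isCofinal := fun σ =>
        let ⟨τ, h, h'⟩ := σ.exists_step v
        ⟨τ, h', h⟩ }
  let σ₀ := S.identityApprox hf hh
  let I := Order.idealOfCofinals σ₀ D
  have hσ₀ : σ₀ ∈ I := Order.mem_idealOfCofinals σ₀ D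
  have hD : ∀ v, ∃ τ, τ ∈ D v ∧ τ ∈ I := Order.cofinal_meets_idealOfCofinals σ₀ D
  have hdir : ∀ {σ τ}, σ ∈ I → τ ∈ I → ∃ ρ ∈ I, σ ≤ ρ ∧ τ ≤ ρ := fun h h' =>
    I.directed _ h _ h'
  have i₀ : ι := Classical.arbitrary ι
  let G : V → V → Prop := fun x y => ∃ σ ∈ I, σ.g x y
  let Φ : ι → V → V → Prop := fun i x t => ∃ σ ∈ I, σ.φ i x t
  have hΦ_inj : ∀ {i x t x' t'}, Φ i x t → Φ i x' t' → (x = x' ↔ t = t') := by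
    rintro i x t x' t' ⟨σ, hσ, h⟩ ⟨τ, hτ, h'⟩
    obtain ⟨ρ, -, h1, h2⟩ := hdir hσ hτ
    exact ρ.φ_inj (h1.2 _ _ _ h) (h2.2 _ _ _ h')
  have hΦ_adj : ∀ {i x t x' t'}, Φ i x t → Φ i x' t' → (R.Adj x x' ↔ R.Adj t t') := by
    rintro i x t x' t' ⟨σ, hσ, h⟩ ⟨τ, hτ, h'⟩
    obtain ⟨ρ, -, h1, h2⟩ := hdir hσ hτ
    exact ρ.φ_adj (h1.2 _ _ _ h) (h2.2 _ _ _ h')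
  have hΦ_G : ∀ {x y}, G x y → ∀ i, ∃ t, Φ i x t ∧ Φ i (S.h i y) (S.f t) := by
    rintro x y ⟨σ, hσ, h⟩ i
    obtain ⟨t, h1, h2⟩ := σ.φ_g h i
    exact ⟨t, ⟨σ, hσ, h1⟩, σ, hσ, h2⟩
  have hG_tot : ∀ x, ∃ y, G x y := fun x =>
    let ⟨τ, ⟨⟨y, hy⟩, _⟩, hτ⟩ := hD x
    ⟨y, τ, hτ, hy⟩
  have hG_surj : ∀ y, ∃ x, G x y := fun y =>
    let ⟨τ, ⟨_, ⟨x, hx⟩, _⟩, hτ⟩ := hD y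
    ⟨x, τ, hτ, hx⟩
  obtain ⟨g, hg⟩ := exists_iso_of_relation (R := R) G hG_tot hG_surj
    (fun {x y x' y'} h h' => by
      obtain ⟨t, h1, h2⟩ := hΦ_G h i₀
      obtain ⟨t', h1', h2'⟩ := hΦ_G h' i₀
      rw [hΦ_inj h1 h1', ← S.f.injective.eq_iff, ← hΦ_inj h2 h2', (S.h i₀).injective.eq_iff])
    (fun {x y x' y'} h h' => by
      obtain ⟨t, h1, h2⟩ := hΦ_G h i₀
      obtain ⟨t', h1', h2'⟩ := hΦ_G h' i₀
      rw [hΦ_adj h1 h1', ← S.f_adj, ← hΦ_adj h2 h2', S.h_adj])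
  have hΦ_tot : ∀ i x, ∃ t, Φ i x t := fun i x =>
    let ⟨_, hy⟩ := hG_tot x
    let ⟨t, ht, _⟩ := hΦ_G hy i
    ⟨t, ht⟩
  have hΦ_f : ∀ {i t}, (∃ x, Φ i x t) → ∃ x, Φ i x (S.f t) := by
    rintro i t ⟨x, hx⟩
    obtain ⟨y, hy⟩ := hG_tot x
    obtain ⟨t', h1, h2⟩ := hΦ_G hy i
    rw [(hΦ_inj hx h1).1 rfl]
    exact ⟨_, h2⟩
  have hΦ_f_inv : ∀ {i t}, (∃ x, Φ i x t) → ∃ x, Φ i x (S.f⁻¹ t) := by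
    rintro i t ⟨x, hx⟩
    obtain ⟨y, hy⟩ := hG_surj ((S.h i)⁻¹ x)
    obtain ⟨t', h1, h2⟩ := hΦ_G hy i
    rw [S.h_h_inv] at h2
    rw [(hΦ_inj hx h2).1 rfl, S.f_inv_f]
    exact ⟨_, h1⟩
  have hΦ_zpow : ∀ {i t}, (∃ x, Φ i x t) → ∀ k : ℤ, ∃ x, Φ i x ((S.f ^ k) t) := by
    intro i t h k
    induction k with
    | zero => exact h
    | succ k ih =>
      rw [add_comm, zpow_one_add]
      exact hΦ_f ih
    | pred k ih =>
      rw [sub_eq_neg_add, zpow_add, zpow_neg_one]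
      exact hΦ_f_inv ih
  have hΦ_surj : ∀ i t, ∃ x, Φ i x t := by
    intro i t
    by_cases ht : t ∈ S.N
    · exact ⟨t, σ₀, hσ₀, ht, rfl⟩
    · obtain ⟨τ, ⟨-, -, h⟩, hτ⟩ := hD t
      obtain ⟨x, w, hx, k, rfl⟩ := h ht i
      exact hΦ_zpow ⟨x, τ, hτ, hx⟩ k
  choose φ hφ using fun i => exists_iso_of_relation (R := R) (Φ i) (hΦ_tot i) (hΦ_surj i)
    hΦ_inj hΦ_adj
  refine ⟨g, φ, fun v hv => (hg v v).1 ⟨σ₀, hσ₀, hv, rfl⟩,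
    fun i v hv => (hφ i v v).1 ⟨σ₀, hσ₀, hv, rfl⟩, fun i => RelIso.ext fun x => ?_⟩
  obtain ⟨t, h1, h2⟩ := hΦ_G ((hg x _).2 rfl) i
  rw [hφ] at h1 h2
  rw [RelIso.mul_apply, RelIso.mul_apply, RelIso.mul_apply, h1, h2]

end Setting

/-! ### Compact sets of automorphisms and orbits -/

theorem isOpen_apply_eq (u v : V) : IsOpen {h : R ≃g R | h u = v} := by
  let _ : TopologicalSpace V := ⊥
  have _ : DiscreteTopology V := ⟨rfl⟩
  have : Continuous fun h : R ≃g R => h u :=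
    (continuous_apply u).comp (continuous_induced_dom (f := fun (h : R ≃g R) (v : V) => h v))
  exact (isOpen_discrete {v}).preimage this

theorem finite_apply_of_isCompact {K : Set (R ≃g R)} (hK : IsCompact K) (v : V) :
    (range fun h : K => (h : R ≃g R) v).Finite := by
  obtain ⟨T, hT⟩ := hK.elim_finite_subcover (fun w => {h : R ≃g R | h v = w})
    (fun w => isOpen_apply_eq v w) fun h _ => mem_iUnion.2 ⟨h v, rfl⟩
  refine T.finite_toSet.subset ?_
  rintro _ ⟨h, rfl⟩
  simpa using hT h.2

theorem finite_inv_apply_of_isCompact {K : Set (R ≃g R)} (hK : IsCompact K) (v : V) :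
    (range fun h : K => (h : R ≃g R)⁻¹ v).Finite := by
  obtain ⟨T, hT⟩ := hK.elim_finite_subcover (fun w => {h : R ≃g R | h w = v})
    (fun w => isOpen_apply_eq w v) fun h _ => mem_iUnion.2 ⟨h⁻¹ v, h.apply_symm_apply v⟩
  refine T.finite_toSet.subset ?_
  rintro _ ⟨h, rfl⟩
  obtain ⟨w, hw, e⟩ := mem_iUnion₂.1 (hT h.2)
  have : (h : R ≃g R) w = v := e
  simpa [← this, show (h : R ≃g R)⁻¹ ((h : R ≃g R) w) = w from
    (h : R ≃g R).symm_apply_apply w] using hw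

theorem mem_finiteOrbitsUnion_iff {f : R ≃g R} {v : V} :
    v ∈ finiteOrbitsUnion f ↔ (range fun k : ℤ => (f ^ k) v).Finite := by
  constructor
  · rintro ⟨_, ⟨⟨w, rfl⟩, hfin⟩, _, rfl, k, rfl⟩
    refine hfin.subset ?_
    rintro _ ⟨l, rfl⟩
    exact ⟨_, rfl, l + k, by rw [zpow_add]; rfl⟩
  · intro h
    refine ⟨_, ⟨⟨v, rfl⟩, h.subset ?_⟩, v, rfl, 0, rfl⟩
    rintro _ ⟨_, rfl, k, rfl⟩
    exact ⟨k, rfl⟩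

theorem apply_mem_finiteOrbitsUnion_iff {f : R ≃g R} {v : V} :
    f v ∈ finiteOrbitsUnion f ↔ v ∈ finiteOrbitsUnion f := by
  rw [mem_finiteOrbitsUnion_iff, mem_finiteOrbitsUnion_iff]
  have : ∀ k : ℤ, (f ^ k) (f v) = (f ^ (k + 1)) v := fun k => by rw [zpow_add_one]; rfl
  simp only [this]
  rw [show (fun k : ℤ => (f ^ (k + 1)) v) = (fun k : ℤ => (f ^ k) v) ∘ Equiv.addRight 1 from rfl,
    EquivLike.range_comp]

theorem mem_finiteOrbitsUnion_of_pow {f : R ≃g R} {n : ℕ} {v : V} (h : (f ^ (n + 1)) v = v) :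
    v ∈ finiteOrbitsUnion f := by
  rw [mem_finiteOrbitsUnion_iff]
  have hfix : ∀ q : ℤ, ((f ^ (n + 1)) ^ q) v = v := by
    intro q
    induction q with
    | zero => rfl
    | succ q ih => rw [zpow_add_one, RelIso.mul_apply, h, ih]
    | pred q ih =>
      rw [zpow_sub_one, RelIso.mul_apply]
      nth_rw 1 [← h]
      rw [RelIso.inv_apply_self, ih]
  refine ((finite_Ico (0 : ℤ) (n + 1 : ℕ)).image fun k => (f ^ k) v).subset ?_
  rintro _ ⟨k, rfl⟩
  have hn : (0 : ℤ) < (n + 1 : ℕ) := by positivity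
  refine ⟨k % (n + 1 : ℕ), ⟨Int.emod_nonneg _ hn.ne', Int.emod_lt_of_pos _ hn⟩, ?_⟩
  change _ = (f ^ k) v
  conv_rhs => rw [← Int.emod_add_mul_ediv k (n + 1 : ℕ), zpow_add, zpow_mul, zpow_natCast,
    RelIso.mul_apply, hfix]

theorem exists_realizes_of_star {f : R ≃g R} {ε : Prop}
    (h : ∀ (M : Finset V) (τ : M → Fin 2),
      ∃ v : V, Realizes R M τ v ∧ v ∉ orbitUnion f (M : Set V) ∧ (R.Adj v (f v) ↔ ε))
    (M : Set V) (τ : V → Prop) (hM : M.Finite) : ∃ v,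
    (∀ w ∈ M, R.Adj w v ↔ τ w) ∧ (∀ w ∈ M, ∀ k : ℤ, (f ^ k) w ≠ v) ∧ (R.Adj v (f v) ↔ ε) := by
  classical
  obtain ⟨v, h1, h2, h3⟩ := h hM.toFinset fun w => if τ w then 1 else 0
  refine ⟨v, fun w hw => ?_, fun w hw k e => h2 ⟨w, by simpa using hw, k, e⟩, h3⟩
  have := h1 ⟨w, by simpa using hw⟩
  simpa using this

theorem exists_conjugations_of_isCompact {V : Type*} [Countable V] {R : SimpleGraph V} {f : R ≃g R}
    (hf : StarZero f ∨ StarOne f) {K : Set (R ≃g R)} (hK : IsCompact K)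
    (hKN : ∀ h ∈ K, ∀ v ∈ finiteOrbitsUnion f, h v = f v) :
    ∃ (g : R ≃g R) (φ : K → (R ≃g R)), (∀ v ∈ finiteOrbitsUnion f, g v = v) ∧
      (∀ h : K, ∀ v ∈ finiteOrbitsUnion f, φ h v = v) ∧
      ∀ h : K, φ h * (h : R ≃g R) * g = f * φ h := by
  rcases K.eq_empty_or_nonempty with rfl | hne
  · exact ⟨1, fun _ => 1, fun _ _ => rfl, fun _ _ _ => rfl, fun h => h.2.elim⟩
  have := hne.to_subtype
  have hO : OrbitCondition f := hf.elim And.left And.left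
  obtain ⟨ε, hε⟩ : ∃ ε : Prop, ∀ (M : Finset V) (τ : M → Fin 2),
      ∃ v : V, Realizes R M τ v ∧ v ∉ orbitUnion f (M : Set V) ∧ (R.Adj v (f v) ↔ ε) := by
    rcases hf with hf | hf
    · exact ⟨False, by simpa using hf.2⟩
    · exact ⟨True, by simpa using hf.2⟩
  let S : Setting R K :=
    { f := f
      h := fun k => k
      N := finiteOrbitsUnion f
      ε := ε
      finite_N := hO.1.sUnion fun O hO => hO.2
      mem_N := fun _ _ => mem_finiteOrbitsUnion_of_pow
      finite_orbit := finite_apply_of_isCompact hK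
      finite_orbit_inv := finite_inv_apply_of_isCompact hK
      exists_realizes := exists_realizes_of_star hε }
  exact S.exists_conjugations (fun _ => apply_mem_finiteOrbitsUnion_iff) fun k v hv => hKN k k.2 v hv
end RandomGraph

theorem theoremt {V : Type*} [Countable V] (R : SimpleGraph V)
    (hR : RandomGraph.IsRandomGraph R) (f : R ≃g R)
    (hf : RandomGraph.StarZero f ∨ RandomGraph.StarOne f)
    (N : Set V) (hN : N = RandomGraph.finiteOrbitsUnion f)
    (K : Set (R ≃g R)) (hK : IsCompact K)
    (hKN : ∀ h ∈ K, ∀ v ∈ N, h v = f v) :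
    RandomGraph.CanBeTranslatedInto K (conjugatesOf f) ∧
      ∃ (g : R ≃g R) (φ : K → (R ≃g R)),
        (∀ v ∈ N, g v = v) ∧
        (∀ h : K, ∀ v ∈ N, φ h v = v) ∧
        ∀ h : K, φ h * (h : R ≃g R) * g = f * φ h := by
  subst hN
  obtain ⟨g, φ, hg, hφ, h⟩ := RandomGraph.exists_conjugations_of_isCompact hf hK hKN
  refine ⟨⟨1, g, fun k hk => isConj_iff.2 ⟨(φ ⟨k, hk⟩)⁻¹, ?_⟩⟩, g, φ, hg, hφ, h⟩
  rw [inv_inv, mul_assoc, ← h ⟨k, hk⟩, one_mul]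
  group
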